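/- There is an absolute constant $c>0$ such that the following holds. Let $n$ be a natural number, let $\mu=\mu_1\otimes\cdots\otimes\mu_n$ be a product of Borel probability measures $\mu_i$ on $[-1,1]$, regarded as a Borel probability measure on $\mathbb R^n$ (with the Euclidean norm $|\cdot|$), and let $f:\mathbb R^n\to\mathbb R$ be convex. Write \[ |\nabla f(x)|=\limsup_{y\to x}\frac{|f(x)-f(y)|}{|x-y|},\qquad x\in\mathbb R^n . \] If $L_0\in\mathbb R$ satisfies $\mu\{x:|\nabla f(x)|\ge L_0\}\le \tfrac12$ (which forces $L_0>0$), then for all $t>0$, \[ (\mu\otimes\mu)\{(x,y):|f(x)-f(y)|\ge t\}\ \le\ 2\inf_{L\ge L_0}\Big[e^{-t^2/(cL^2)}+\mu\{x:|\nabla f(x)|>L\}\Big]. \] -/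

import Mathlib

open MeasureTheory Filter Topology
open scoped ENNReal

/-- The generalized modulus of the gradient
`|∇f(x)| = limsup_{y → x} |f(x) - f(y)| / d(x, y)`, with values in `[0, ∞]`
(it is `0` at an isolated point). -/
noncomputable def gradModulus {M : Type*} [MetricSpace M] (f : M → ℝ) (x : M) : ℝ≥0∞ :=
  limsup (fun y => ENNReal.ofReal (|f x - f y| / dist x y)) (𝓝[≠] x)

/-- The product measure `ν₁ ⊗ ⋯ ⊗ νₙ` on Euclidean space `ℝⁿ`. -/
noncomputable def euclideanProduct {n : ℕ} (ν : Fin n → Measure ℝ) :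
    Measure (EuclideanSpace ℝ (Fin n)) :=
  (Measure.pi ν).map (WithLp.toLp 2)

/-!
The deviation inequality for a convex function `f` is reduced to the one for a convex Lipschitz
function. For `L > 0`, the infimum convolution `g x = inf_y (f y + L |x - y|)` is convex and
`L`-Lipschitz. By convexity, the slope of `f` from `x` along a segment is monotone, so
`|∇f(x)| ≤ L` yields `f x ≤ f y + L |x - y|` for all `y`, and then `g x = f x`
(`ConvexOn.exists_lipschitz_eq_of_gradModulus_le`). Hence `f` and `g` agree at both points of a pair
outside an event of probability at most `2 μ {|∇f| > L}`.

For `g`, the argument is Maurey's. The infimum convolution `Q` of a convex function `φ` with the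
cost `|x - y|² / 16` satisfies `(∫ e^Q) (∫ e^{-φ}) ≤ 1` for every product measure on `[-1, 1]ⁿ`
(`lintegral_infConv_mul_lintegral_exp_neg_le_one`). On the line this follows from
`e^{u - u²} ≤ 2 - e^{-u}` on `[0, 1]`; the passage to products rests on the convexity of partial
minima and of `v ↦ log ∫ e^{h v}`. Applied to `φ = λ g`, for which `Q ≥ λ g - 4 λ² L²`, it bounds
the Laplace transform of `g x - g y` for independent `x` and `y` by `e^{4 λ² L²}`. Markov's
inequality with `λ = t / (8 L²)` gives the Gaussian tail with the constant `16`.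
-/

/-! ### Probability measures on `[-1, 1]` -/

lemma ae_mem_Icc_of_measure_eq_one {ν : Measure ℝ} [IsProbabilityMeasure ν]
    (hν : ν (Set.Icc (-1) 1) = 1) : ∀ᵐ x ∂ν, x ∈ Set.Icc (-1 : ℝ) 1 := by
  rw [← prob_compl_eq_zero_iff measurableSet_Icc] at hν
  exact measure_eq_zero_iff_ae_notMem.1 hν |>.mono fun x hx => by simpa using hx

lemma Continuous.integrable_of_measure_Icc_eq_one {ν : Measure ℝ} [IsProbabilityMeasure ν]
    (hν : ν (Set.Icc (-1) 1) = 1) {f : ℝ → ℝ} (hf : Continuous f) : Integrable f ν := by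
  have h := hf.integrableOn_Icc (a := -1) (b := 1) (μ := ν)
  rwa [IntegrableOn, Measure.restrict_eq_self_of_ae_mem (ae_mem_Icc_of_measure_eq_one hν)] at h

/-! ### The infimum-convolution inequality on the line -/

/-- Writing `e^{-u} + e^{u - u²} = 2 e^{-u²/2} cosh (u - u²/2)`, this is `cosh x ≤ e^{x²/2}`. -/
lemma exp_sub_sq_le {u : ℝ} (h0 : 0 ≤ u) (h1 : u ≤ 1) :
    Real.exp (u - u ^ 2) ≤ 2 - Real.exp (-u) := by
  have h := Real.cosh_le_exp_half_sq (u - u ^ 2 / 2)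
  have h2 : Real.exp ((u - u ^ 2 / 2) ^ 2 / 2) ≤ Real.exp (u ^ 2 / 2) := by
    apply Real.exp_le_exp.2
    have : 0 ≤ u - u ^ 2 / 2 := by nlinarith
    have : (u - u ^ 2 / 2) ^ 2 ≤ u ^ 2 := by gcongr; nlinarith
    linarith
  rw [Real.cosh_eq] at h
  have h3 : Real.exp (u - u ^ 2 / 2) + Real.exp (-(u - u ^ 2 / 2)) ≤ 2 * Real.exp (u ^ 2 / 2) := by
    linarith
  have h4 := mul_le_mul_of_nonneg_right h3 (Real.exp_pos (-(u ^ 2 / 2))).le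
  rw [add_mul, mul_assoc, ← Real.exp_add, ← Real.exp_add, ← Real.exp_add] at h4
  ring_nf at h4 ⊢
  rw [Real.exp_zero] at h4
  linarith

/-- The value of the infimum convolution of a convex function at a point `x` of `[-1, 1]`, bounded
through points on the segment from `x` to a minimizer `y₀`. -/
lemma exp_le_of_le_infConv {f : ℝ → ℝ} (hf : ConvexOn ℝ Set.univ f) {x y₀ r : ℝ}
    (hx : x ∈ Set.Icc (-1 : ℝ) 1) (hy₀ : y₀ ∈ Set.Icc (-1 : ℝ) 1) (hmin : f y₀ ≤ f x)
    (hr : ∀ y ∈ Set.Icc (-1 : ℝ) 1, r ≤ f y + (x - y) ^ 2 / 16) :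
    Real.exp r ≤ Real.exp (f y₀) * (2 - Real.exp (f y₀ - f x)) := by
  have key : ∀ θ ∈ Set.Icc (0 : ℝ) 1, r ≤ f y₀ + ((f x - f y₀) - θ * (f x - f y₀) + θ ^ 2 / 4) := by
    rintro θ ⟨h0, h1⟩
    have hc := hf.2 (Set.mem_univ x) (Set.mem_univ y₀) (sub_nonneg.2 h1) h0 (by ring)
    have hm : (1 - θ) • x + θ • y₀ ∈ Set.Icc (-1 : ℝ) 1 :=
      convex_Icc _ _ hx hy₀ (sub_nonneg.2 h1) h0 (by ring)
    have h := hr _ hm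
    simp only [smul_eq_mul] at hc h
    have h2 : (x - ((1 - θ) * x + θ * y₀)) ^ 2 = θ ^ 2 * (x - y₀) ^ 2 := by ring
    have h3 : (x - y₀) ^ 2 ≤ 4 := by nlinarith [hx.1, hx.2, hy₀.1, hy₀.2]
    have h4 : θ ^ 2 * (x - y₀) ^ 2 ≤ θ ^ 2 * 4 := by gcongr
    rw [h2] at h
    linarith
  have hu : 0 ≤ f x - f y₀ := sub_nonneg.2 hmin
  rw [show f y₀ - f x = -(f x - f y₀) by ring]
  generalize f x - f y₀ = u at *
  suffices Real.exp (r - f y₀) ≤ 2 - Real.exp (-u) by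
    rw [show r = f y₀ + (r - f y₀) by ring, Real.exp_add]
    gcongr
  -- The minimum of `u - θ u + θ² / 4` over `θ ∈ [0, 1]` is at `θ = min (2 u) 1`.
  rcases le_total u (1 / 2) with h | h
  · have := key (2 * u) ⟨by linarith, by linarith⟩
    refine le_trans (Real.exp_le_exp.2 ?_) (exp_sub_sq_le hu (by linarith))
    linarith
  · have := key 1 ⟨by norm_num, le_rfl⟩
    have h2 := exp_sub_sq_le (u := 1 / 2) (by norm_num) (by norm_num)
    have h3 : Real.exp (-u) ≤ Real.exp (-(1 / 2)) := Real.exp_le_exp.2 (by linarith)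
    have h4 : Real.exp (r - f y₀) ≤ Real.exp (1 / 2 - (1 / 2) ^ 2) :=
      Real.exp_le_exp.2 (by linarith)
    linarith

/-- Maurey's inequality on the line. With `s = e^m ∫ e^{-f}`, where `m` is the minimum of `f`, the
product is at most `s (2 - s) ≤ 1`. -/
lemma lintegral_exp_infConv_mul_le_one {ν : Measure ℝ} [IsProbabilityMeasure ν]
    (hν : ν (Set.Icc (-1) 1) = 1) {f h : ℝ → ℝ} (hf : ConvexOn ℝ Set.univ f) (hfc : Continuous f)
    (hh : ∀ x ∈ Set.Icc (-1 : ℝ) 1, ∀ y ∈ Set.Icc (-1 : ℝ) 1, h x ≤ f y + (x - y) ^ 2 / 16) :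
    (∫⁻ x, ENNReal.ofReal (Real.exp (h x)) ∂ν) * (∫⁻ x, ENNReal.ofReal (Real.exp (-f x)) ∂ν)
      ≤ 1 := by
  obtain ⟨y₀, hy₀, hmin⟩ := isCompact_Icc.exists_isMinOn
    (Set.nonempty_Icc.2 (by norm_num : (-1 : ℝ) ≤ 1)) hfc.continuousOn
  have hae := ae_mem_Icc_of_measure_eq_one hν
  set m := f y₀
  set B := ∫ x, Real.exp (-f x) ∂ν
  have hi : Integrable (fun x => Real.exp (-f x)) ν :=
    (by fun_prop : Continuous fun x => Real.exp (-f x)).integrable_of_measure_Icc_eq_one hν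
  have hpt : ∀ᵐ x ∂ν, Real.exp (h x) ≤ Real.exp m * (2 - Real.exp m * Real.exp (-f x)) := by
    filter_upwards [hae] with x hx
    have := exp_le_of_le_infConv hf hx hy₀ (hmin hx) (hh x hx)
    rwa [sub_eq_add_neg m, Real.exp_add] at this
  have hint : Integrable (fun x => Real.exp m * (2 - Real.exp m * Real.exp (-f x))) ν :=
    ((integrable_const _).sub (hi.const_mul _)).const_mul _
  have h1 : ∫⁻ x, ENNReal.ofReal (Real.exp (h x)) ∂ν ≤
      ENNReal.ofReal (Real.exp m * (2 - Real.exp m * B)) := by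
    calc _ ≤ ∫⁻ x, ENNReal.ofReal (Real.exp m * (2 - Real.exp m * Real.exp (-f x))) ∂ν :=
          lintegral_mono_ae (hpt.mono fun x hx => ENNReal.ofReal_le_ofReal hx)
      _ = ENNReal.ofReal (∫ x, Real.exp m * (2 - Real.exp m * Real.exp (-f x)) ∂ν) :=
          (ofReal_integral_eq_lintegral_ofReal hint
            (hpt.mono fun x hx => (Real.exp_pos _).le.trans hx)).symm
      _ = _ := by
          rw [integral_const_mul, integral_sub (integrable_const _) (hi.const_mul _),
            integral_const_mul]
          simp [B]
  have hB : 0 ≤ B := integral_nonneg fun x => (Real.exp_pos _).le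
  rw [← ofReal_integral_eq_lintegral_ofReal hi (ae_of_all _ fun x => (Real.exp_pos _).le)]
  refine (mul_le_mul_left h1 _).trans ?_
  rw [← ENNReal.ofReal_mul' hB, ← ENNReal.ofReal_one]
  apply ENNReal.ofReal_le_ofReal
  nlinarith [sq_nonneg (Real.exp m * B - 1)]

/-! ### Convexity of partial minima and of log-integrals of exponentials -/

/-- Partial minimization over a compact convex set preserves convexity. -/
lemma ConvexOn.sInf_image_of_isCompact {E : Type*} [AddCommGroup E] [Module ℝ E] {K : Set ℝ}
    (hK : IsCompact K) (hKc : Convex ℝ K) (hKn : K.Nonempty) {F : ℝ → E → ℝ}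
    (hF : ConvexOn ℝ Set.univ fun p : ℝ × E => F p.1 p.2)
    (hFc : ∀ v, Continuous fun a => F a v) :
    ConvexOn ℝ Set.univ fun v => sInf ((fun a => F a v) '' K) := by
  refine ⟨convex_univ, fun v _ w _ α β hα hβ hαβ => ?_⟩
  obtain ⟨a, ha, ha', -⟩ := hK.exists_sInf_image_eq_and_le hKn (hFc v).continuousOn
  obtain ⟨b, hb, hb', -⟩ := hK.exists_sInf_image_eq_and_le hKn (hFc w).continuousOn
  simp only [ha', hb']
  refine (csInf_le (hK.image (hFc _)).bddBelow ⟨α • a + β • b, hKc ha hb hα hβ hαβ, rfl⟩).trans ?_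
  exact hF.2 (Set.mem_univ (a, v)) (Set.mem_univ (b, w)) hα hβ hαβ

/-- `v ↦ log ∫ e^{h v}` is convex when `h` is convex in `v`. After normalizing
both integrals to `1`, the claim is the convexity of `exp`. -/
lemma ConvexOn.log_integral_exp {E : Type*} [AddCommGroup E] [Module ℝ E] {Ω : Type*}
    [MeasurableSpace Ω] {ν : Measure Ω} [NeZero ν] {h : E → Ω → ℝ}
    (hc : ∀ x, ConvexOn ℝ Set.univ fun v => h v x)
    (hi : ∀ v, Integrable (fun x => Real.exp (h v x)) ν) :
    ConvexOn ℝ Set.univ fun v => Real.log (∫ x, Real.exp (h v x) ∂ν) := by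
  refine ⟨convex_univ, fun v _ w _ α β hα hβ hαβ => ?_⟩
  have hpos : ∀ v, 0 < ∫ x, Real.exp (h v x) ∂ν := fun v => integral_exp_pos (hi v)
  set g : E → ℝ := fun v => Real.log (∫ x, Real.exp (h v x) ∂ν)
  have hg : ∀ v, Real.exp (-g v) * ∫ x, Real.exp (h v x) ∂ν = 1 := fun v => by
    rw [Real.exp_neg, Real.exp_log (hpos v), inv_mul_cancel₀ (hpos v).ne']
  change Real.log _ ≤ α * g v + β * g w
  rw [Real.log_le_iff_le_exp (hpos _)]
  have hpt : ∀ x, Real.exp (h (α • v + β • w) x) ≤ Real.exp (α * g v + β * g w) *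
      (α * (Real.exp (-g v) * Real.exp (h v x)) + β * (Real.exp (-g w) * Real.exp (h w x))) := by
    intro x
    have h1 := (hc x).2 (Set.mem_univ v) (Set.mem_univ w) hα hβ hαβ
    have h2 := convexOn_exp.2 (Set.mem_univ (-g v + h v x)) (Set.mem_univ (-g w + h w x))
      hα hβ hαβ
    simp only [smul_eq_mul, Real.exp_add (-g _)] at h1 h2
    refine le_trans ?_ (mul_le_mul_of_nonneg_left h2 (Real.exp_pos _).le)
    rw [← Real.exp_add]
    apply Real.exp_le_exp.2
    linarith
  have hiv := ((hi v).const_mul (Real.exp (-g v))).const_mul α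
  have hiw := ((hi w).const_mul (Real.exp (-g w))).const_mul β
  refine (integral_mono (hi _) ((hiv.add hiw).const_mul _) hpt).trans ?_
  simp only [Pi.add_apply]
  rw [integral_const_mul, integral_add hiv hiw]
  simp only [integral_const_mul, hg]
  simp [hαβ]

/-! ### Tensorization -/

lemma lintegral_pi_succ {n : ℕ} (ν : Fin (n + 1) → Measure ℝ) [∀ i, IsProbabilityMeasure (ν i)]
    {Φ : (Fin (n + 1) → ℝ) → ℝ≥0∞} (hΦ : Measurable Φ) :
    ∫⁻ x, Φ x ∂Measure.pi ν =
      ∫⁻ v, ∫⁻ a, Φ (Fin.cons a v) ∂ν 0 ∂Measure.pi fun j : Fin n => ν j.succ := by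
  have h := (measurePreserving_piFinSuccAbove ν 0).symm.lintegral_comp hΦ
  rw [← h, lintegral_prod_symm]
  · simp [MeasurableEquiv.piFinSuccAbove, Fin.insertNthEquiv]
  · exact (hΦ.comp (MeasurableEquiv.measurable _)).aemeasurable

lemma measurable_fin_cons {n : ℕ} :
    Measurable fun p : (Fin n → ℝ) × ℝ => (Fin.cons p.2 p.1 : Fin (n + 1) → ℝ) := by
  refine measurable_pi_iff.2 fun i => ?_
  refine Fin.cases ?_ (fun j => ?_) i
  · simpa using! measurable_snd
  · simpa using! (measurable_pi_apply j).comp measurable_fst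

lemma ConvexOn.continuous_of_univ {E : Type*} [NormedAddCommGroup E] [NormedSpace ℝ E]
    [FiniteDimensional ℝ E] {f : E → ℝ} (hf : ConvexOn ℝ Set.univ f) : Continuous f :=
  continuousOn_univ.1 (hf.continuousOn isOpen_univ)

/-- Maurey's inequality (the convex property `(τ)`) for product measures on the cube:
`Φ` is any function lying below the exponential of the infimum convolution of `f` with the cost
`|x - y|² / 16`. -/
theorem lintegral_infConv_mul_lintegral_exp_neg_le_one {n : ℕ} (ν : Fin n → Measure ℝ)
    [∀ i, IsProbabilityMeasure (ν i)] (hν : ∀ i, ν i (Set.Icc (-1) 1) = 1)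
    {f : (Fin n → ℝ) → ℝ} (hf : ConvexOn ℝ Set.univ f)
    {Φ : (Fin n → ℝ) → ℝ≥0∞} (hΦ : Measurable Φ)
    (h : ∀ x y, (∀ i, x i ∈ Set.Icc (-1 : ℝ) 1) → (∀ i, y i ∈ Set.Icc (-1 : ℝ) 1) →
      Φ x ≤ ENNReal.ofReal (Real.exp (f y + (∑ i, (x i - y i) ^ 2) / 16))) :
    (∫⁻ x, Φ x ∂Measure.pi ν) * (∫⁻ x, ENNReal.ofReal (Real.exp (-f x)) ∂Measure.pi ν) ≤ 1 := by
  induction n with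
  | zero =>
    rw [Measure.pi_of_empty ν, lintegral_dirac, lintegral_dirac]
    refine (mul_le_mul_left (h _ isEmptyElim (fun i => i.elim0) (fun i => i.elim0)) _).trans ?_
    rw [← ENNReal.ofReal_mul (Real.exp_pos _).le, ← Real.exp_add]
    simp
  | succ n ih =>
    have hfc : Continuous f := hf.continuous_of_univ
    have hcons : Continuous fun p : ℝ × (Fin n → ℝ) => (Fin.cons p.1 p.2 : Fin (n + 1) → ℝ) :=
      Continuous.finCons (A := fun _ => ℝ) continuous_fst continuous_snd
    set K := Set.Icc (-1 : ℝ) 1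
    have hKn : K.Nonempty := Set.nonempty_Icc.2 (by norm_num)
    -- `q v x` is the infimum convolution of `f` in the first variable only, and
    -- `g v` the logarithm of the integral of its exponential.
    set q : (Fin n → ℝ) → ℝ → ℝ :=
      fun v x => sInf ((fun a => f (Fin.cons a v) + (x - a) ^ 2 / 16) '' K) with hq
    have hqle : ∀ v x, ∀ a ∈ K, q v x ≤ f (Fin.cons a v) + (x - a) ^ 2 / 16 := fun v x a ha =>
      csInf_le (isCompact_Icc.image
        ((hfc.comp (hcons.comp (Continuous.prodMk_left v))).add (by fun_prop))).bddBelow ⟨a, ha, rfl⟩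
    have hqcont : ∀ v, Continuous (q v) := fun v =>
      isCompact_Icc.continuous_sInf (((hfc.comp (hcons.comp
        (continuous_snd.prodMk continuous_const)))).add (by fun_prop))
    have hqconv : ∀ x, ConvexOn ℝ Set.univ fun v => q v x := by
      intro x
      refine ConvexOn.sInf_image_of_isCompact isCompact_Icc (convex_Icc _ _) hKn
        (F := fun a v => f (Fin.cons a v) + (x - a) ^ 2 / 16) ?_ (fun v =>
        (hfc.comp (hcons.comp (Continuous.prodMk_left v))).add (by fun_prop))
      refine ⟨convex_univ, ?_⟩
      rintro ⟨a, v⟩ - ⟨b, w⟩ - α β hα hβ hαβ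
      have h1 := hf.2 (Set.mem_univ (Fin.cons a v)) (Set.mem_univ (Fin.cons b w)) hα hβ hαβ
      have h2 : α • (Fin.cons a v : Fin (n + 1) → ℝ) + β • (Fin.cons b w : Fin (n + 1) → ℝ)
          = Fin.cons (α • a + β • b) (α • v + β • w) := by
        ext i; refine Fin.cases ?_ (fun j => ?_) i <;> simp
      rw [h2] at h1
      have h3 := (even_two.convexOn_pow (𝕜 := ℝ)).2 (Set.mem_univ (x - a)) (Set.mem_univ (x - b))
        hα hβ hαβ
      have h4 : α • (x - a) + β • (x - b) = x - (α • a + β • b) := by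
        simp only [smul_eq_mul]; linear_combination x * hαβ
      rw [h4] at h3
      simp only [smul_eq_mul, Prod.smul_mk, Prod.mk_add_mk] at h1 h3 ⊢
      linarith
    have hqint : ∀ v, Integrable (fun x => Real.exp (q v x)) (ν 0) := fun v =>
      (Real.continuous_exp.comp (hqcont v)).integrable_of_measure_Icc_eq_one (hν 0)
    set g : (Fin n → ℝ) → ℝ := fun v => Real.log (∫ x, Real.exp (q v x) ∂ν 0) with hg
    have hgconv : ConvexOn ℝ Set.univ g := ConvexOn.log_integral_exp hqconv hqint
    have hgexp : ∀ v, ∫⁻ x, ENNReal.ofReal (Real.exp (q v x)) ∂ν 0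
        = ENNReal.ofReal (Real.exp (g v)) := fun v => by
      rw [hg, Real.exp_log (integral_exp_pos (hqint v)),
        ofReal_integral_eq_lintegral_ofReal (hqint v) (ae_of_all _ fun x => (Real.exp_pos _).le)]
    -- The upper integrals: integrate the hypothesis over the first coordinate of `x`.
    have hupper : ∀ v w, (∀ i, v i ∈ K) → (∀ i, w i ∈ K) → ∫⁻ a, Φ (Fin.cons a v) ∂ν 0
        ≤ ENNReal.ofReal (Real.exp (g w + (∑ i, (v i - w i) ^ 2) / 16)) := by
      intro v w hv hw
      rw [Real.exp_add, ENNReal.ofReal_mul (Real.exp_pos _).le, ← hgexp,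
        ← lintegral_mul_const' _ _ ENNReal.ofReal_ne_top]
      refine lintegral_mono_ae ((ae_mem_Icc_of_measure_eq_one (hν 0)).mono fun x hx => ?_)
      rw [← ENNReal.ofReal_mul (Real.exp_pos _).le, ← Real.exp_add]
      obtain ⟨a, ha, ha', -⟩ := isCompact_Icc.exists_sInf_image_eq_and_le hKn
        ((hfc.comp (hcons.comp (Continuous.prodMk_left w))).add
          (by fun_prop : Continuous fun a => (x - a) ^ 2 / 16)).continuousOn
      refine (h (Fin.cons x v) (Fin.cons a w) ?_ ?_).trans (ENNReal.ofReal_le_ofReal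
        (Real.exp_le_exp.2 (le_of_eq ?_)))
      · exact fun i => Fin.cases hx (fun j => by simpa using hv j) i
      · exact fun i => Fin.cases ha (fun j => by simpa using hw j) i
      · have : q w x = f (Fin.cons a w) + (x - a) ^ 2 / 16 := ha'
        rw [this, Fin.sum_univ_succ]
        simp only [Fin.cons_zero, Fin.cons_succ]
        ring
    -- The lower integrals: the one-dimensional inequality for `f (·, v)`.
    have hlower : ∀ v, ∫⁻ a, ENNReal.ofReal (Real.exp (-f (Fin.cons a v))) ∂ν 0
        ≤ ENNReal.ofReal (Real.exp (-g v)) := by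
      intro v
      have hconv : ConvexOn ℝ Set.univ fun a => f (Fin.cons a v) := by
        refine ⟨convex_univ, fun a _ b _ α β hα hβ hαβ => ?_⟩
        have h1 := hf.2 (Set.mem_univ (Fin.cons a v)) (Set.mem_univ (Fin.cons b v)) hα hβ hαβ
        have h2 : α • (Fin.cons a v : Fin (n + 1) → ℝ) + β • (Fin.cons b v : Fin (n + 1) → ℝ)
            = Fin.cons (α • a + β • b) v := by
          ext i
          refine Fin.cases (by simp) (fun j => ?_) i
          simp only [Pi.add_apply, Pi.smul_apply, Fin.cons_succ, smul_eq_mul]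
          linear_combination v j * hαβ
        rwa [h2] at h1
      have h1 := lintegral_exp_infConv_mul_le_one (hν 0) hconv
        (hfc.comp (hcons.comp (Continuous.prodMk_left v))) (h := q v)
        (fun x _ y hy => hqle v x y hy)
      rw [hgexp, mul_comm] at h1
      rw [Real.exp_neg, ENNReal.ofReal_inv_of_pos (Real.exp_pos _), ENNReal.le_inv_iff_mul_le]
      exact h1
    rw [lintegral_pi_succ ν hΦ, lintegral_pi_succ ν (by fun_prop)]
    refine (mul_le_mul_right (lintegral_mono hlower) _).trans ?_
    exact ih (fun j => ν j.succ) (fun j => hν j.succ) hgconv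
      (Measurable.lintegral_prod_right' (hΦ.comp measurable_fin_cons)) hupper

/-! ### Deviation inequality for convex Lipschitz functions -/

/-- Maurey's inequality for `lam • g`; the cost absorbs the Lipschitz oscillation,
`lam * L * r ≤ 4 * lam² * L² + r² / 16`. -/
lemma lintegral_exp_mul_lintegral_exp_neg_le {n : ℕ} (ν : Fin n → Measure ℝ)
    [∀ i, IsProbabilityMeasure (ν i)] (hν : ∀ i, ν i (Set.Icc (-1) 1) = 1)
    {g : EuclideanSpace ℝ (Fin n) → ℝ} (hg : ConvexOn ℝ Set.univ g) {L : ℝ}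
    (hL : ∀ x y, g x ≤ g y + L * dist x y) {lam : ℝ} (hlam : 0 ≤ lam) :
    (∫⁻ x, ENNReal.ofReal (Real.exp (lam * g x)) ∂euclideanProduct ν) *
      (∫⁻ x, ENNReal.ofReal (Real.exp (-(lam * g x))) ∂euclideanProduct ν) ≤
      ENNReal.ofReal (Real.exp (4 * lam ^ 2 * L ^ 2)) := by
  have hgc : Continuous g := hg.continuous_of_univ
  have hm : Measurable (WithLp.toLp 2 : (Fin n → ℝ) → EuclideanSpace ℝ (Fin n)) :=
    (PiLp.continuous_toLp 2 _).measurable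
  have hfconv : ConvexOn ℝ Set.univ fun v : Fin n → ℝ => lam * g (WithLp.toLp 2 v) :=
    (hg.comp_linearMap (WithLp.linearEquiv 2 ℝ (Fin n → ℝ)).symm.toLinearMap).smul hlam
  have key := lintegral_infConv_mul_lintegral_exp_neg_le_one ν hν hfconv
    (Φ := fun v => ENNReal.ofReal (Real.exp (lam * g (WithLp.toLp 2 v))) *
      ENNReal.ofReal (Real.exp (-(4 * lam ^ 2 * L ^ 2))))
    (by fun_prop) (by
      intro x y _ _
      rw [← ENNReal.ofReal_mul (Real.exp_pos _).le, ← Real.exp_add]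
      apply ENNReal.ofReal_le_ofReal (Real.exp_le_exp.2 _)
      have h1 := hL (WithLp.toLp 2 x) (WithLp.toLp 2 y)
      have h2 : ∑ i, (x i - y i) ^ 2 = dist (WithLp.toLp 2 x) (WithLp.toLp 2 y) ^ 2 := by
        rw [EuclideanSpace.dist_eq, Real.sq_sqrt (Finset.sum_nonneg fun i _ => sq_nonneg _)]
        simp [Real.dist_eq, sq_abs]
      rw [h2]
      generalize dist (WithLp.toLp 2 x) (WithLp.toLp 2 y) = r at *
      nlinarith [mul_le_mul_of_nonneg_left h1 hlam, sq_nonneg (2 * lam * L - r / 4)])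
  rw [euclideanProduct, lintegral_map (by fun_prop) hm, lintegral_map (by fun_prop) hm]
  rw [lintegral_mul_const' _ _ ENNReal.ofReal_ne_top, mul_right_comm, Real.exp_neg,
    ENNReal.ofReal_inv_of_pos (Real.exp_pos _), ← div_eq_mul_inv] at key
  simpa using (ENNReal.div_le_iff (by simp [Real.exp_pos]) ENNReal.ofReal_ne_top).1 key

instance {n : ℕ} (ν : Fin n → Measure ℝ) [∀ i, IsProbabilityMeasure (ν i)] :
    IsProbabilityMeasure (euclideanProduct ν) :=
  Measure.isProbabilityMeasure_map (PiLp.continuous_toLp 2 _).measurable.aemeasurable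

/-- Markov's inequality for `e^{lam (g x - g y)}`, whose integral factorizes. -/
lemma prod_measure_le_sub_of_convexOn {n : ℕ} (ν : Fin n → Measure ℝ)
    [∀ i, IsProbabilityMeasure (ν i)] (hν : ∀ i, ν i (Set.Icc (-1) 1) = 1)
    {g : EuclideanSpace ℝ (Fin n) → ℝ} (hg : ConvexOn ℝ Set.univ g) {L : ℝ} (hL0 : 0 < L)
    (hL : ∀ x y, g x ≤ g y + L * dist x y) {t : ℝ} (ht : 0 < t) :
    ((euclideanProduct ν).prod (euclideanProduct ν)) {p | t ≤ g p.1 - g p.2} ≤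
      ENNReal.ofReal (Real.exp (-t ^ 2 / (16 * L ^ 2))) := by
  have hgc : Continuous g := hg.continuous_of_univ
  -- The minimizer of `-lam * t + 4 * lam² * L²`.
  set lam := t / (8 * L ^ 2)
  have hlam : 0 < lam := by positivity
  set μ := euclideanProduct ν
  set F : EuclideanSpace ℝ (Fin n) × EuclideanSpace ℝ (Fin n) → ℝ≥0∞ := fun p =>
    ENNReal.ofReal (Real.exp (lam * g p.1)) * ENNReal.ofReal (Real.exp (-(lam * g p.2)))
  have hsub : {p : EuclideanSpace ℝ (Fin n) × EuclideanSpace ℝ (Fin n) | t ≤ g p.1 - g p.2} ⊆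
      {p | ENNReal.ofReal (Real.exp (lam * t)) ≤ F p} := by
    intro p hp
    change t ≤ g p.1 - g p.2 at hp
    change ENNReal.ofReal (Real.exp (lam * t)) ≤ ENNReal.ofReal _ * ENNReal.ofReal _
    rw [← ENNReal.ofReal_mul (Real.exp_pos _).le, ← Real.exp_add]
    refine ENNReal.ofReal_le_ofReal (Real.exp_le_exp.2 ?_)
    nlinarith
  refine (measure_mono hsub).trans ((meas_ge_le_lintegral_div (by fun_prop)
    (by simp [Real.exp_pos]) ENNReal.ofReal_ne_top).trans ?_)
  simp only [F]
  rw [lintegral_prod_mul (f := fun x => ENNReal.ofReal (Real.exp (lam * g x)))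
    (g := fun x => ENNReal.ofReal (Real.exp (-(lam * g x)))) (by fun_prop) (by fun_prop)]
  refine (ENNReal.div_le_div_right
    (lintegral_exp_mul_lintegral_exp_neg_le ν hν hg hL hlam.le) _).trans (le_of_eq ?_)
  rw [← ENNReal.ofReal_div_of_pos (Real.exp_pos _), ← Real.exp_sub]
  congr 2
  simp only [lam]
  field_simp
  ring

lemma prod_measure_le_abs_sub_of_convexOn {n : ℕ} (ν : Fin n → Measure ℝ)
    [∀ i, IsProbabilityMeasure (ν i)] (hν : ∀ i, ν i (Set.Icc (-1) 1) = 1)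
    {g : EuclideanSpace ℝ (Fin n) → ℝ} (hg : ConvexOn ℝ Set.univ g) {L : ℝ} (hL0 : 0 < L)
    (hL : ∀ x y, g x ≤ g y + L * dist x y) {t : ℝ} (ht : 0 < t) :
    ((euclideanProduct ν).prod (euclideanProduct ν)) {p | t ≤ |g p.1 - g p.2|} ≤
      2 * ENNReal.ofReal (Real.exp (-t ^ 2 / (16 * L ^ 2))) := by
  have hgc : Continuous g := hg.continuous_of_univ
  have h := prod_measure_le_sub_of_convexOn ν hν hg hL0 hL ht
  have hset : {p : EuclideanSpace ℝ (Fin n) × EuclideanSpace ℝ (Fin n) | t ≤ |g p.1 - g p.2|} =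
      {p | t ≤ g p.1 - g p.2} ∪ Prod.swap ⁻¹' {p | t ≤ g p.1 - g p.2} := by
    ext p
    simp [le_abs]
  have hmeas : MeasurableSet
      {p : EuclideanSpace ℝ (Fin n) × EuclideanSpace ℝ (Fin n) | t ≤ g p.1 - g p.2} :=
    measurableSet_le (by fun_prop) (by fun_prop)
  rw [hset, two_mul]
  refine (measure_union_le _ _).trans (add_le_add h ?_)
  rwa [Measure.measurePreserving_swap.measure_preimage hmeas.nullMeasurableSet]

/-! ### Lipschitz regularization of a convex function -/

/-- If the gradient of a convex function at `x` has modulus at most `L`, then `f` lies above the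
cone of slope `-L` with apex `(x, f x)`: the slopes of `f` from `x` along a segment increase. -/
lemma ConvexOn.le_add_mul_dist_of_gradModulus_le {E : Type*} [NormedAddCommGroup E]
    [NormedSpace ℝ E] {f : E → ℝ} (hf : ConvexOn ℝ Set.univ f) {L : ℝ} (hL : 0 ≤ L) {x : E}
    (hx : gradModulus f x ≤ ENNReal.ofReal L) (y : E) : f x ≤ f y + L * dist x y := by
  rcases eq_or_ne x y with rfl | hxy
  · simp
  have hd : 0 < dist x y := dist_pos.2 hxy
  suffices h : (f x - f y) / dist x y ≤ L by
    rw [div_le_iff₀ hd] at h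
    linarith
  refine le_of_forall_gt_imp_ge_of_dense fun L' hL' => ?_
  have hev : ∀ᶠ z in 𝓝[≠] x, ENNReal.ofReal (|f x - f z| / dist x z) < ENNReal.ofReal L' :=
    eventually_lt_of_limsup_lt (hx.trans_lt ((ENNReal.ofReal_lt_ofReal_iff (hL.trans_lt hL')).2 hL'))
  have htend : Tendsto (fun s : ℝ => AffineMap.lineMap x y s) (𝓝[>] 0) (𝓝[≠] x) := by
    refine tendsto_nhdsWithin_iff.2 ⟨?_, ?_⟩
    · have : Continuous fun s : ℝ => AffineMap.lineMap x y s := AffineMap.lineMap_continuous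
      simpa using (this.tendsto 0).mono_left nhdsWithin_le_nhds
    · filter_upwards [self_mem_nhdsWithin] with s hs
      have hs' : s ≠ 0 := ne_of_gt hs
      simp [AffineMap.lineMap_eq_left_iff, hxy, hs']
  obtain ⟨s, hs, hs0, hs1⟩ := ((htend.eventually hev).and
    (Ioo_mem_nhdsGT (zero_lt_one : (0 : ℝ) < 1))).exists
  rw [ENNReal.ofReal_lt_ofReal_iff (hL.trans_lt hL'), dist_left_lineMap, Real.norm_eq_abs,
    abs_of_pos hs0, div_lt_iff₀ (by positivity)] at hs
  have hc := hf.2 (Set.mem_univ x) (Set.mem_univ y) (sub_nonneg.2 hs1.le) hs0.le (by ring)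
  rw [← AffineMap.lineMap_apply_module] at hc
  simp only [smul_eq_mul] at hc
  rw [div_le_iff₀ hd]
  have h1 := le_abs_self (f x - f (AffineMap.lineMap x y s))
  have h2 : s * (f x - f y) ≤ s * (L' * dist x y) := by linarith
  exact le_of_mul_le_mul_left h2 hs0

/-- The largest `L`-Lipschitz minorant `x ↦ inf_y (f y + L |x - y|)` of a convex function `f` is
convex, and it agrees with `f` wherever the gradient of `f` has modulus at most `L`. -/
lemma ConvexOn.exists_lipschitz_eq_of_gradModulus_le {E : Type*} [NormedAddCommGroup E]
    [NormedSpace ℝ E] {f : E → ℝ} (hf : ConvexOn ℝ Set.univ f) {L : ℝ} (hL : 0 ≤ L)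
    (hne : ∃ x, gradModulus f x ≤ ENNReal.ofReal L) :
    ∃ g : E → ℝ, ConvexOn ℝ Set.univ g ∧ (∀ x y, g x ≤ g y + L * dist x y) ∧
      ∀ x, gradModulus f x ≤ ENNReal.ofReal L → g x = f x := by
  obtain ⟨x₀, hx₀⟩ := hne
  have hbdd : ∀ x, BddBelow (Set.range fun y => f y + L * dist x y) := by
    refine fun x => ⟨f x₀ - L * dist x₀ x, ?_⟩
    rintro _ ⟨y, rfl⟩
    have h1 := hf.le_add_mul_dist_of_gradModulus_le hL hx₀ y
    have h2 := mul_le_mul_of_nonneg_left (dist_triangle x₀ x y) hL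
    change _ ≤ f y + L * dist x y
    linarith
  refine ⟨fun x => ⨅ y, (f y + L * dist x y), ⟨convex_univ, ?_⟩, ?_, ?_⟩
  · intro x _ y _ α β hα hβ hαβ
    refine le_of_forall_pos_le_add fun ε hε => ?_
    obtain ⟨a, ha⟩ := exists_lt_of_ciInf_lt (lt_add_of_pos_right (⨅ z, (f z + L * dist x z)) hε)
    obtain ⟨b, hb⟩ := exists_lt_of_ciInf_lt (lt_add_of_pos_right (⨅ z, (f z + L * dist y z)) hε)
    refine (ciInf_le (hbdd _) (α • a + β • b)).trans ?_
    have h1 := hf.2 (Set.mem_univ a) (Set.mem_univ b) hα hβ hαβ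
    have h2 : dist (α • x + β • y) (α • a + β • b) ≤ α * dist x a + β * dist y b := by
      refine (dist_add_add_le _ _ _ _).trans (le_of_eq ?_)
      rw [dist_smul₀, dist_smul₀, Real.norm_of_nonneg hα, Real.norm_of_nonneg hβ]
    have h3 := mul_le_mul_of_nonneg_left h2 hL
    have h4 := mul_le_mul_of_nonneg_left ha.le hα
    have h5 := mul_le_mul_of_nonneg_left hb.le hβ
    have h6 : α * ε + β * ε = ε := by rw [← add_mul, hαβ, one_mul]
    simp only [smul_eq_mul] at h1 ⊢
    linarith
  · intro x y
    rw [← sub_le_iff_le_add]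
    refine le_ciInf fun z => ?_
    have h1 := ciInf_le (hbdd x) z
    have h2 := mul_le_mul_of_nonneg_left (dist_triangle x y z) hL
    linarith
  · intro x hx
    refine le_antisymm ((ciInf_le (hbdd x) x).trans (by simp)) (le_ciInf fun y => ?_)
    exact hf.le_add_mul_dist_of_gradModulus_le hL hx y

/-! ### The deviation inequality -/

/-- The inequality for one `L`: outside the event that one of the two points has gradient larger
than `L`, the function `f` may be replaced by its Lipschitz regularization. -/
lemma prod_measure_le_abs_sub_le_exp_add {n : ℕ} (ν : Fin n → Measure ℝ)
    [∀ i, IsProbabilityMeasure (ν i)] (hν : ∀ i, ν i (Set.Icc (-1) 1) = 1)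
    {f : EuclideanSpace ℝ (Fin n) → ℝ} (hf : ConvexOn ℝ Set.univ f) {L : ℝ} (hL : 0 < L)
    {t : ℝ} (ht : 0 < t) :
    ((euclideanProduct ν).prod (euclideanProduct ν)) {p | t ≤ |f p.1 - f p.2|} ≤
      2 * (ENNReal.ofReal (Real.exp (-t ^ 2 / (16 * L ^ 2))) +
        euclideanProduct ν {x | ENNReal.ofReal L < gradModulus f x}) := by
  set μ := euclideanProduct ν
  set A := {x | ENNReal.ofReal L < gradModulus f x}
  by_cases hne : ∃ x, gradModulus f x ≤ ENNReal.ofReal L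
  · obtain ⟨g, hg, hgL, hgf⟩ := hf.exists_lipschitz_eq_of_gradModulus_le hL.le hne
    have hsub : {p : EuclideanSpace ℝ (Fin n) × EuclideanSpace ℝ (Fin n) | t ≤ |f p.1 - f p.2|} ⊆
        {p | t ≤ |g p.1 - g p.2|} ∪ (A ×ˢ Set.univ ∪ Set.univ ×ˢ A) := by
      intro p hp
      by_cases h1 : p.1 ∈ A
      · exact Or.inr (Or.inl ⟨h1, trivial⟩)
      by_cases h2 : p.2 ∈ A
      · exact Or.inr (Or.inr ⟨trivial, h2⟩)
      left
      simpa [hgf _ (not_lt.1 h1), hgf _ (not_lt.1 h2)] using hp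
    refine (measure_mono hsub).trans ((measure_union_le _ _).trans ?_)
    rw [mul_add]
    refine add_le_add (prod_measure_le_abs_sub_of_convexOn ν hν hg hL hgL ht)
      ((measure_union_le _ _).trans ?_)
    simp [Measure.prod_prod, two_mul]
  · -- No point has a small gradient, so the last term is already `1`.
    have hA : A = Set.univ := Set.eq_univ_of_forall fun x => by
      by_contra hx
      exact hne ⟨x, not_lt.1 hx⟩
    rw [hA, measure_univ, two_mul]
    exact prob_le_one.trans (le_add_right le_add_self)

theorem corollary7p4 :
    ∃ c : ℝ, 0 < c ∧
      ∀ (n : ℕ) (ν : Fin n → Measure ℝ),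
        (∀ i, IsProbabilityMeasure (ν i)) →
        (∀ i, ν i (Set.Icc (-1) 1) = 1) →
        ∀ (μ : Measure (EuclideanSpace ℝ (Fin n))), μ = euclideanProduct ν →
        ∀ (f : EuclideanSpace ℝ (Fin n) → ℝ), ConvexOn ℝ Set.univ f →
        ∀ L₀ : ℝ, μ {x | ENNReal.ofReal L₀ ≤ gradModulus f x} ≤ 1 / 2 →
        ∀ t : ℝ, 0 < t →
          (μ.prod μ) {p | t ≤ |f p.1 - f p.2|} ≤
            2 * ⨅ (L : ℝ) (_ : L₀ ≤ L),
              (ENNReal.ofReal (Real.exp (-t ^ 2 / (c * L ^ 2))) +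
                μ {x | ENNReal.ofReal L < gradModulus f x}) := by
  refine ⟨16, by norm_num, ?_⟩
  rintro n ν hprob hν μ rfl f hf L₀ hL₀ t ht
  -- For `L₀ ≤ 0` the set in the hypothesis is the whole space, of measure `1`.
  have hpos : 0 < L₀ := by
    by_contra hneg
    rw [ENNReal.ofReal_of_nonpos (not_lt.1 hneg)] at hL₀
    simp only [zero_le, Set.ofPred_true, measure_univ] at hL₀
    exact absurd hL₀ (not_le.2 (by simp))
  rw [ENNReal.mul_iInf_of_ne two_ne_zero ENNReal.ofNat_ne_top]
  refine le_iInf fun L => ?_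
  rw [ENNReal.mul_iInf_of_ne two_ne_zero ENNReal.ofNat_ne_top]
  exact le_iInf fun hL => prod_measure_le_abs_sub_le_exp_add ν hν hf (hpos.trans_le hL) ht
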